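/- Let $n\ge 1$ and let $\mathbb{H}^n$ be the generalized Heisenberg group of real $(n+2)\times(n+2)$ matrices with ones on the diagonal, first row $(1,y_1,\dots,y_n,z)$, last column $(z,x_1,\dots,x_n,1)^{\mathsf T}$ and zeros elsewhere; let $(x,y,z)\in\mathbb{R}^{2n+1}$ be the corresponding global coordinates, and let $\mathfrak{h}^n$ be the Lie algebra of right-invariant vector fields on $\mathbb{H}^n$. Let $Z=\partial/\partial z\in\mathfrak{h}^n$, which generates the centre of $\mathfrak{h}^n$. Consider the linear system $$(\Sigma)\qquad \dot g=\mathcal{X}(g)+\sum_{j=1}^m u_j\,B_j(g),$$ where $\mathcal{X}$ is a linear vector field on $\mathbb{H}^n$ (a smooth vector field whose flow is a one-parameter group of automorphisms of $\mathbb{H}^n$), $B_1,\dots,B_m\in\mathfrak{h}^n$, and the controls $u=(u_1,\dots,u_m)$ are measurable and bounded on each compact time interval, with values in $\mathbb{R}^m$. Let $D=-\mathrm{ad}(\mathcal{X})$ be the derivation $Y\mapsto-[\mathcal{X},Y]$ of $\mathfrak{h}^n$. Suppose that the rank condition holds, that is, the Lie algebra generated by all the $D^kB_j$ ($k\ge 0$,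 $1\le j\le m$) is equal to $\mathfrak{h}^n$, and that $Z$ belongs to the Lie algebra generated by $B_1,\dots,B_m$. Then $(\Sigma)$ is controllable in exact time $T$ for every $T>0$: for all $g,h\in\mathbb{H}^n$ there is a control $u$ on $[0,T]$ whose trajectory starting from $g$ at time $0$ is at $h$ at time $T$. -/

import Mathlib

open scoped ContDiff

noncomputable section

/-- The generalized Heisenberg group `ℍⁿ` in its canonical global coordinates `(x, y, z)`, with
`x, y ∈ ℝⁿ` and `z ∈ ℝ`. The point `(x, y, z)` stands for the `(n+2) × (n+2)` unipotent matrix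
`Heis.toMatrix (x, y, z)` below. The vector space structure is that of the coordinate space
`ℝ²ⁿ⁺¹` (the chart, and each tangent space); the group structure is written multiplicatively. -/
def Heis (n : ℕ) : Type := (Fin n → ℝ) × (Fin n → ℝ) × ℝ

namespace Heis

variable {n : ℕ}

instance : NormedAddCommGroup (Heis n) :=
  inferInstanceAs (NormedAddCommGroup ((Fin n → ℝ) × (Fin n → ℝ) × ℝ))

instance : NormedSpace ℝ (Heis n) :=
  inferInstanceAs (NormedSpace ℝ ((Fin n → ℝ) × (Fin n → ℝ) × ℝ))

instance : FiniteDimensional ℝ (Heis n) :=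
  inferInstanceAs (FiniteDimensional ℝ ((Fin n → ℝ) × (Fin n → ℝ) × ℝ))

instance : CompleteSpace (Heis n) :=
  inferInstanceAs (CompleteSpace ((Fin n → ℝ) × (Fin n → ℝ) × ℝ))

/-- The point with coordinates `(x, y, z)`. -/
def mk (x y : Fin n → ℝ) (z : ℝ) : Heis n := (x, y, z)

/-- The `x`-coordinates. -/
def x (g : Heis n) : Fin n → ℝ := g.1

/-- The `y`-coordinates. -/
def y (g : Heis n) : Fin n → ℝ := g.2.1

/-- The `z`-coordinate. -/
def z (g : Heis n) : ℝ := g.2.2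

theorem ext_coord {g h : Heis n} (hx : g.x = h.x) (hy : g.y = h.y) (hz : g.z = h.z) : g = h :=
  Prod.ext hx (Prod.ext hy hz)

@[simp] theorem mk_x (a b : Fin n → ℝ) (c : ℝ) : (mk a b c).x = a := rfl
@[simp] theorem mk_y (a b : Fin n → ℝ) (c : ℝ) : (mk a b c).y = b := rfl
@[simp] theorem mk_z (a b : Fin n → ℝ) (c : ℝ) : (mk a b c).z = c := rfl
@[simp] theorem add_x (g h : Heis n) : (g + h).x = g.x + h.x := rfl
@[simp] theorem add_y (g h : Heis n) : (g + h).y = g.y + h.y := rfl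
@[simp] theorem add_z (g h : Heis n) : (g + h).z = g.z + h.z := rfl
@[simp] theorem smul_x (c : ℝ) (g : Heis n) : (c • g).x = c • g.x := rfl
@[simp] theorem smul_y (c : ℝ) (g : Heis n) : (c • g).y = c • g.y := rfl
@[simp] theorem smul_z (c : ℝ) (g : Heis n) : (c • g).z = c * g.z := rfl

/-- Matrix multiplication in the coordinates `(x, y, z)`, see `Heis.toMatrix_mul`. -/
instance : Mul (Heis n) :=
  ⟨fun g h => mk (g.x + h.x) (g.y + h.y) (g.z + h.z + ∑ i, g.y i * h.x i)⟩

instance : One (Heis n) := ⟨mk 0 0 0⟩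

instance : Inv (Heis n) := ⟨fun g => mk (-g.x) (-g.y) (-g.z + ∑ i, g.y i * g.x i)⟩

@[simp] theorem mul_x (g h : Heis n) : (g * h).x = g.x + h.x := rfl
@[simp] theorem mul_y (g h : Heis n) : (g * h).y = g.y + h.y := rfl
@[simp] theorem mul_z (g h : Heis n) : (g * h).z = g.z + h.z + ∑ i, g.y i * h.x i := rfl
@[simp] theorem one_x : (1 : Heis n).x = 0 := rfl
@[simp] theorem one_y : (1 : Heis n).y = 0 := rfl
@[simp] theorem one_z : (1 : Heis n).z = 0 := rfl
@[simp] theorem inv_x (g : Heis n) : (g⁻¹).x = -g.x := rfl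
@[simp] theorem inv_y (g : Heis n) : (g⁻¹).y = -g.y := rfl
@[simp] theorem inv_z (g : Heis n) : (g⁻¹).z = -g.z + ∑ i, g.y i * g.x i := rfl

instance : Group (Heis n) :=
  Group.ofLeftAxioms
    (fun a b c => by
      apply ext_coord
      · simp [add_assoc]
      · simp [add_assoc]
      · simp only [mul_z, mul_x, mul_y, Pi.add_apply, mul_add, add_mul, Finset.sum_add_distrib]
        ring)
    (fun a => by apply ext_coord <;> simp)
    (fun a => by apply ext_coord <;> simp)

/-- The matrix with ones on the diagonal, first row `(1, y₁, …, yₙ, z)`, last column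
`(z, x₁, …, xₙ, 1)`, and zeros elsewhere. -/
def toMatrix (g : Heis n) : Matrix (Fin (n + 2)) (Fin (n + 2)) ℝ :=
  1 + ∑ i : Fin n, g.y i • Matrix.single 0 i.castSucc.succ 1
    + ∑ i : Fin n, g.x i • Matrix.single i.castSucc.succ (Fin.last (n + 1)) 1
    + g.z • Matrix.single 0 (Fin.last (n + 1)) 1

/-- The group law of `Heis n` is matrix multiplication. -/
theorem toMatrix_mul (g h : Heis n) : (g * h).toMatrix = g.toMatrix * h.toMatrix := by
  have h0 : ∀ i : Fin n, Fin.last (n + 1) ≠ i.castSucc.succ := fun i h => by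
    have := congrArg Fin.val h
    simp at this
    omega
  have h1 : ∀ i : Fin n, i.castSucc.succ ≠ (0 : Fin (n + 2)) := fun i => Fin.succ_ne_zero _
  have h2 : Fin.last (n + 1) ≠ 0 := Fin.last_pos.ne'
  simp only [toMatrix, mul_x, mul_y, mul_z, Pi.add_apply, add_smul, Finset.sum_add_distrib,
    mul_add, add_mul, one_mul, mul_one, Finset.sum_mul, Finset.mul_sum, smul_mul_assoc,
    mul_smul_comm, Matrix.single_mul_single_of_ne _ _ _ _ (h0 _),
    Matrix.single_mul_single_of_ne _ _ _ _ (h1 _), Matrix.single_mul_single_of_ne _ _ _ _ h2,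
    smul_zero, Finset.sum_const_zero, add_zero, Finset.sum_smul]
  have h3 : ∀ i j : Fin n, Matrix.single (0 : Fin (n + 2)) i.castSucc.succ (1 : ℝ) *
      Matrix.single j.castSucc.succ (Fin.last (n + 1)) 1 =
      if i = j then Matrix.single 0 (Fin.last (n + 1)) 1 else 0 := fun i j => by
    split_ifs with hij
    · subst hij
      simp
    · exact Matrix.single_mul_single_of_ne _ _ _ _ (by simpa using hij) _
  simp only [h3, smul_ite, smul_zero, Finset.sum_ite_eq', Finset.mem_univ,
    if_true, smul_add, smul_smul, Finset.sum_add_distrib]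
  simp only [mul_comm]
  abel

theorem toMatrix_injective :
    Function.Injective (toMatrix : Heis n → Matrix (Fin (n + 2)) (Fin (n + 2)) ℝ) := by
  intro g h hgh
  have h0 : ∀ i : Fin n, Fin.last (n + 1) ≠ i.castSucc.succ := fun i h => by
    have := congrArg Fin.val h
    simp at this
    omega
  have h1 : ∀ i : Fin n, i.castSucc.succ ≠ (0 : Fin (n + 2)) := fun i => Fin.succ_ne_zero _
  have h2 : Fin.last (n + 1) ≠ 0 := Fin.last_pos.ne'
  apply ext_coord
  · funext i
    have := congrFun (congrFun hgh i.castSucc.succ) (Fin.last (n + 1))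
    simpa [toMatrix, Matrix.sum_apply, Matrix.single_apply, Matrix.one_apply, h0, h1, h2,
      (h0 _).symm, (h1 _).symm, h2.symm] using this
  · funext i
    have := congrFun (congrFun hgh 0) i.castSucc.succ
    simpa [toMatrix, Matrix.sum_apply, Matrix.single_apply, Matrix.one_apply, h0, h1, h2,
      (h0 _).symm, (h1 _).symm, h2.symm] using this
  · have := congrFun (congrFun hgh 0) (Fin.last (n + 1))
    simpa [toMatrix, Matrix.sum_apply, Matrix.single_apply, Matrix.one_apply, h0, h1, h2,
      (h0 _).symm, (h1 _).symm, h2.symm] using this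

end Heis

/-- A vector field on `ℍⁿ`, written in the canonical coordinates. -/
abbrev HeisField (n : ℕ) : Type := Heis n → Heis n

/-- `B` is right-invariant: it is preserved by the differential of each right translation
`k ↦ k * h`. -/
def IsRightInvariant {n : ℕ} (B : HeisField n) : Prop :=
  ∀ g h : Heis n, B (g * h) = fderiv ℝ (fun k : Heis n => k * h) g (B g)

/-- The central vector field `Z = ∂/∂z`. -/
def heisZ (n : ℕ) : HeisField n := fun _ => Heis.mk 0 0 1

/-- `𝒳` is a linear vector field: a smooth vector field whose flow is a one-parameter group
`(φ_t)` of automorphisms of the group `ℍⁿ`. (Each `φ_t` is smooth since `𝒳` is.) -/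
def IsLinearField {n : ℕ} (𝒳 : HeisField n) : Prop :=
  ContDiff ℝ ∞ 𝒳 ∧
    ∃ φ : ℝ → (Heis n ≃* Heis n),
      (∀ g, φ 0 g = g) ∧ (∀ s t g, φ (s + t) g = φ s (φ t g)) ∧
      ∀ g t, HasDerivAt (fun s => φ s g) (𝒳 (φ t g)) t

/-- `D = -ad(𝒳)`, that is `D Y = -[𝒳, Y]`, with the Lie bracket of vector fields. -/
def adDer {n : ℕ} (𝒳 : HeisField n) (Y : HeisField n) : HeisField n :=
  -VectorField.lieBracket ℝ 𝒳 Y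

/-- The Lie algebra generated by a set `S` of vector fields: the smallest linear subspace
that contains `S` and is closed under the Lie bracket of vector fields. -/
def lieGenerated {n : ℕ} (S : Set (HeisField n)) : Submodule ℝ (HeisField n) :=
  sInf {W | S ⊆ W ∧ ∀ V ∈ W, ∀ U ∈ W, VectorField.lieBracket ℝ V U ∈ W}

/-- The rank condition: the Lie algebra generated by all the `D^k B_j` is the whole Lie algebra of
right-invariant vector fields. -/
def HeisRankCondition {n m : ℕ} (𝒳 : HeisField n) (B : Fin m → HeisField n) : Prop :=
  (lieGenerated {Y | ∃ (k : ℕ) (j : Fin m), Y = (adDer 𝒳)^[k] (B j)} : Set (HeisField n)) =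
    {Y | IsRightInvariant Y}

/-- `γ` is, on `[0, T]`, the (Carathéodory) trajectory starting from `g` of
`ġ = 𝒳(g) + ∑ⱼ uⱼ Bⱼ(g)` for the control `u`. -/
def IsTrajectory {n m : ℕ} (𝒳 : HeisField n) (B : Fin m → HeisField n) (T : ℝ)
    (u : ℝ → Fin m → ℝ) (g : Heis n) (γ : ℝ → Heis n) : Prop :=
  ContinuousOn γ (Set.Icc 0 T) ∧
    ∀ t ∈ Set.Icc 0 T, γ t = g + ∫ s in (0 : ℝ)..t, (𝒳 (γ s) + ∑ j, u s j • B j (γ s))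

/-- The set of points reached from `g` in time exactly `T`, by means of measurable controls
bounded on `[0, T]` with values in `ℝᵐ`. -/
def reachableSet {n m : ℕ} (𝒳 : HeisField n) (B : Fin m → HeisField n) (g : Heis n) (T : ℝ) :
    Set (Heis n) :=
  {h | ∃ u : ℝ → Fin m → ℝ, Measurable u ∧ (∃ C : ℝ, ∀ t ∈ Set.Icc 0 T, ‖u t‖ ≤ C) ∧
    ∃ γ : ℝ → Heis n, IsTrajectory 𝒳 B T u g γ ∧ γ T = h}

/-- Controllability in exact time `T`: every point is reached from every point in time `T`. -/
def ControllableInExactTime {n m : ℕ} (𝒳 : HeisField n) (B : Fin m → HeisField n) (T : ℝ) :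
    Prop :=
  ∀ g : Heis n, reachableSet 𝒳 B g T = Set.univ

end

/-! With `v = (x, y)`, the system takes the form `v' = A v + b u`, `z' = λ z + F v + c u + β (b u,
v)`: a linear field is linear in `v` and affine in `z` with constant slope, and a right-invariant
field has constant horizontal part. Brackets of right-invariant fields are vertical, so the rank
condition yields Kalman's condition for `(A, b)` (`HeisRankCondition.eq_zero`), and `v` can be
steered at will. It remains to reach the right `z`.

By `exists_combination_or_noncommuting`, either `Z` is a combination of the `B_j` or two of them do
not commute. A constant control in the first case, a unit loop run at frequency `k` in the second,
pushes `z` at rate `k κ`, `κ ≠ 0`, and otherwise acts through primitives bounded uniformly in `k`. A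
bounded correction, depending continuously on `k`, brings `v` exactly to its target. Hence `z T` is
a continuous bounded function of `k` plus a nonzero multiple of `k`, and the intermediate value
theorem selects `k` (`exists_steering`). -/

/-! ### Linear control systems and Kalman's criterion. -/

section LinearControl

variable {E U : Type*} [NormedAddCommGroup E] [NormedSpace ℝ E] [NormedAddCommGroup U]
  [NormedSpace ℝ U]

/-- The propagator `exp (t A)` of the linear equation `v' = A v`. -/
noncomputable def propagator (A : E →L[ℝ] E) (t : ℝ) : E →L[ℝ] E := NormedSpace.exp (t • A)

theorem propagator_zero (A : E →L[ℝ] E) : propagator A 0 = 1 := by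
  simp [propagator, NormedSpace.exp_zero]

/-- The solution of `v' = A v + f` with initial value `v₀`, by variation of constants. -/
noncomputable def duhamel (A : E →L[ℝ] E) (v₀ : E) (f : ℝ → E) (t : ℝ) : E :=
  propagator A t (v₀ + ∫ s in (0 : ℝ)..t, propagator A (-s) (f s))

theorem duhamel_zero (A : E →L[ℝ] E) (v₀ : E) (f : ℝ → E) : duhamel A v₀ f 0 = v₀ := by
  simp [duhamel, propagator_zero]

variable [CompleteSpace E]

theorem hasDerivAt_propagator (A : E →L[ℝ] E) (t : ℝ) :
    HasDerivAt (propagator A) (A * propagator A t) t :=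
  hasDerivAt_exp_smul_const' A t

theorem hasDerivAt_propagator_right (A : E →L[ℝ] E) (t : ℝ) :
    HasDerivAt (propagator A) (propagator A t * A) t :=
  hasDerivAt_exp_smul_const A t

theorem continuous_propagator (A : E →L[ℝ] E) : Continuous (propagator A) :=
  continuous_iff_continuousAt.2 fun t => (hasDerivAt_propagator A t).continuousAt

theorem propagator_mul_neg (A : E →L[ℝ] E) (t : ℝ) :
    propagator A t * propagator A (-t) = 1 := by
  let _ : NormedAlgebra ℚ (E →L[ℝ] E) := NormedAlgebra.restrictScalars ℚ ℝ _
  rw [propagator, propagator, ← NormedSpace.exp_add_of_commute, ← add_smul]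
  · simp [NormedSpace.exp_zero]
  · exact ((Commute.refl A).smul_left t).smul_right (-t)

theorem propagator_apply_neg (A : E →L[ℝ] E) (t : ℝ) (w : E) :
    propagator A t (propagator A (-t) w) = w := by
  have := congrArg (fun L : E →L[ℝ] E => L w) (propagator_mul_neg A t)
  simpa using this

theorem propagator_neg_apply (A : E →L[ℝ] E) (t : ℝ) (w : E) :
    propagator A (-t) (propagator A t w) = w := by
  simpa using propagator_apply_neg A (-t) w

theorem continuous_propagator_neg_apply (A : E →L[ℝ] E) {f : ℝ → E} (hf : Continuous f) :
    Continuous fun s => propagator A (-s) (f s) :=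
  ((continuous_propagator A).comp continuous_neg).clm_apply hf

theorem hasDerivAt_duhamel (A : E →L[ℝ] E) (v₀ : E) {f : ℝ → E} (hf : Continuous f) (t : ℝ) :
    HasDerivAt (duhamel A v₀ f) (A (duhamel A v₀ f t) + f t) t := by
  have h := (hasDerivAt_propagator A t).clm_apply
    (((continuous_propagator_neg_apply A hf).integral_hasStrictDerivAt 0 t).hasDerivAt.const_add v₀)
  exact h.congr_deriv (by simp [duhamel, propagator_apply_neg])

/-- Supplies the continuity in the frequency `k` on which the final intermediate value argument
rests. -/
theorem continuous_duhamel {X : Type*} [TopologicalSpace X] (A : E →L[ℝ] E) {v₀ : X → E}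
    {f : X → ℝ → E} (hv : Continuous v₀) (hf : Continuous (Function.uncurry f)) :
    Continuous fun p : X × ℝ => duhamel A (v₀ p.1) (f p.1) p.2 := by
  refine ((continuous_propagator A).comp continuous_snd).clm_apply ((hv.comp continuous_fst).add ?_)
  refine intervalIntegral.continuous_parametric_primitive_of_continuous
    (f := fun k s => propagator A (-s) (f k s)) ?_
  exact ((continuous_propagator A).comp continuous_snd.neg).clm_apply hf

/-- The control-to-state map of `v' = A v + b u`, transported back to time `0`. -/
noncomputable def controlMap (A : E →L[ℝ] E) (b : U →L[ℝ] E) (T : ℝ) : C(ℝ, U) →ₗ[ℝ] E where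
  toFun u := ∫ s in (0 : ℝ)..T, propagator A (-s) (b (u s))
  map_add' u w := by
    have h (u : C(ℝ, U)) := continuous_propagator_neg_apply A (b.continuous.comp u.continuous)
    simpa using intervalIntegral.integral_add ((h u).intervalIntegrable 0 T)
      ((h w).intervalIntegrable 0 T)
  map_smul' a u := by simp

/-- Kalman's criterion for the linear system `v' = A v + b u`. -/
theorem controlMap_surjective [FiniteDimensional ℝ E] {ι : Type*} [Fintype ι]
    (A : E →L[ℝ] E) (b : (ι → ℝ) →L[ℝ] E)
    (hA : ∀ ψ : E →L[ℝ] ℝ, (∀ (k : ℕ) w, ψ ((A ^ k) (b w)) = 0) → ψ = 0) {T : ℝ} (hT : 0 < T) :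
    Function.Surjective (controlMap A b T) := by
  classical
  rw [← LinearMap.range_eq_top]
  by_contra hne
  -- If the range is proper, a nonzero functional `ψ` kills it.
  obtain ⟨ψ', hψ0, hψ⟩ := Submodule.exists_le_ker_of_lt_top _ (lt_top_iff_ne_top.2 hne)
  set ψ : E →L[ℝ] ℝ := LinearMap.toContinuousLinearMap ψ'
  have hcont : ∀ w, Continuous fun s => ψ (propagator A (-s) (b w)) := fun w =>
    ψ.continuous.comp (continuous_propagator_neg_apply A continuous_const)
  -- The control is the observation of `ψ` itself, so that `ψ` of its effect is `∫ |u|²`; this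
  -- vanishes, hence so does `u` on `[0, T]`.
  let u : C(ℝ, ι → ℝ) := ⟨fun s j => ψ (propagator A (-s) (b (Pi.single j 1))),
    continuous_pi fun j => hcont _⟩
  have hexp : ∀ s w, ψ (propagator A (-s) (b w)) = ∑ j, w j * u s j := by
    intro s w
    have := (ψ.toLinearMap ∘ₗ (propagator A (-s)).toLinearMap ∘ₗ b.toLinearMap).pi_apply_eq_sum_univ w
    simp only [LinearMap.comp_apply, ContinuousLinearMap.coe_coe, smul_eq_mul] at this
    rw [this]
    refine Finset.sum_congr rfl fun j _ => ?_
    simp only [u, ContinuousMap.coe_mk]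
    congr!
    simp [Pi.single_apply, eq_comm]
  have hint : ∫ s in (0 : ℝ)..T, ∑ j, u s j * u s j = 0 := by
    have h1 : ψ (controlMap A b T u) = 0 := hψ ⟨u, rfl⟩
    have h2 := ψ.intervalIntegral_comp_comm (μ := MeasureTheory.volume)
      ((continuous_propagator_neg_apply A (b.continuous.comp u.continuous)).intervalIntegrable 0 T)
    simp only [Function.comp_apply, hexp] at h2
    rw [h2]
    exact h1
  have hzero : ∀ s ∈ Set.Icc 0 T, u s = 0 := by
    intro s hs
    by_contra hus
    refine hint.not_gt (intervalIntegral.integral_pos hT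
      (continuous_finsetSum _ fun j _ => ((continuous_apply j).comp u.continuous).mul
        ((continuous_apply j).comp u.continuous)).continuousOn
      (fun _ _ => Finset.sum_nonneg fun j _ => mul_self_nonneg _) ⟨s, hs, ?_⟩)
    obtain ⟨j, hj⟩ := Function.ne_iff.1 hus
    exact Finset.sum_pos' (fun j _ => mul_self_nonneg _) ⟨j, Finset.mem_univ j,
      mul_self_pos.2 hj⟩
  -- Each derivative in `s` brings out one more factor `A`; the open interval makes the identity
  -- hold near every point, so it can be differentiated.
  have hpow : ∀ (k : ℕ) w, ∀ s ∈ Set.Ioo 0 T, ψ (propagator A (-s) ((A ^ k) (b w))) = 0 := by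
    intro k w
    induction k with
    | zero =>
      intro s hs
      simp [hexp, hzero s (Set.Ioo_subset_Icc_self hs)]
    | succ k ih =>
      intro s hs
      have h1 : HasDerivAt (fun s => ψ (propagator A (-s) ((A ^ k) (b w))))
          (ψ (-(propagator A (-s) (A ((A ^ k) (b w)))))) s := by
        have h2 := ((hasDerivAt_propagator_right A (-s)).scomp s (hasDerivAt_neg s)).clm_apply
          (hasDerivAt_const s ((A ^ k) (b w)))
        refine ψ.hasFDerivAt.comp_hasDerivAt s (by simpa using h2)
      have h3 : HasDerivAt (fun s => ψ (propagator A (-s) ((A ^ k) (b w)))) 0 s :=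
        (hasDerivAt_const s (0 : ℝ)).congr_of_eventuallyEq
          (Filter.eventually_of_mem (isOpen_Ioo.mem_nhds hs) fun x hx => ih x hx)
      have h4 := h1.unique h3
      rw [map_neg, neg_eq_zero] at h4
      rw [pow_succ']
      exact h4
  -- Any interior time would do: the propagator there is invertible, so Kalman's condition for the
  -- transported functional forces `ψ = 0`.
  have hmem : T / 2 ∈ Set.Ioo 0 T := ⟨by linarith, by linarith⟩
  have h5 := hA (ψ ∘L propagator A (-(T / 2))) fun k w => hpow k w _ hmem
  apply hψ0
  ext v
  have := congrArg (fun L : E →L[ℝ] ℝ => L (propagator A (T / 2) v)) h5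
  simpa [propagator_neg_apply, ψ] using this

/-- A linear choice of a control with a prescribed effect. -/
theorem exists_controlMap_rightInverse [FiniteDimensional ℝ E] {A : E →L[ℝ] E} {b : U →L[ℝ] E}
    {T : ℝ} (h : Function.Surjective (controlMap A b T)) :
    ∃ R : E → ℝ → U, Continuous (Function.uncurry R) ∧
      ∀ ξ, ∫ s in (0 : ℝ)..T, propagator A (-s) (b (R ξ s)) = ξ := by
  obtain ⟨R, hR⟩ := (controlMap A b T).exists_rightInverse_of_surjective (LinearMap.range_eq_top.2 h)
  refine ⟨fun ξ s => R ξ s, ?_, fun ξ => LinearMap.congr_fun hR ξ⟩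
  -- A linear section defined on a finite-dimensional space is automatically continuous.
  exact continuous_eval.comp
    ((R.continuous_of_finiteDimensional.comp continuous_fst).prodMk continuous_snd)

end LinearControl

/-! ### Bounds uniform in the parameter. -/

section UniformBound

variable {ι X Y E : Type*} [SeminormedAddCommGroup X] [SeminormedAddCommGroup Y]
  [NormedAddCommGroup E] [NormedSpace ℝ E]

/-- A family of functions of time is bounded on `[0, T]`, uniformly in the parameter. -/
def UniformlyBounded (T : ℝ) (f : ι → ℝ → X) : Prop :=
  ∃ C, ∀ k, ∀ t ∈ Set.Icc 0 T, ‖f k t‖ ≤ C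

namespace UniformlyBounded

variable {T : ℝ}

/-- Closed balls are compact, so a continuous map is bounded on them; any continuous expression in
bounded families is thus bounded. -/
theorem comp [ProperSpace X] {f : ι → ℝ → X} (hf : UniformlyBounded T f) {g : X → Y}
    (hg : Continuous g) : UniformlyBounded T fun k t => g (f k t) := by
  obtain ⟨C, hC⟩ := hf
  obtain ⟨M, hM⟩ := (isCompact_closedBall (0 : X) C).exists_bound_of_continuousOn hg.continuousOn
  exact ⟨M, fun k t ht => hM _ (by simpa using hC k t ht)⟩

theorem prodMk {f : ι → ℝ → X} {g : ι → ℝ → Y} (hf : UniformlyBounded T f)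
    (hg : UniformlyBounded T g) : UniformlyBounded T fun k t => (f k t, g k t) := by
  obtain ⟨C, hC⟩ := hf
  obtain ⟨M, hM⟩ := hg
  exact ⟨max C M, fun k t ht => max_le_max (hC k t ht) (hM k t ht)⟩

theorem of_continuous {f : ℝ → X} (hf : Continuous f) : UniformlyBounded T fun _ : ι => f := by
  obtain ⟨C, hC⟩ := (isCompact_Icc (a := (0 : ℝ)) (b := T)).exists_bound_of_continuousOn
    hf.continuousOn
  exact ⟨C, fun _ => hC⟩

theorem at_time {f : ι → ℝ → X} (hf : UniformlyBounded T f) {t : ℝ} (ht : t ∈ Set.Icc 0 T) :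
    UniformlyBounded T fun k _ => f k t := by
  obtain ⟨C, hC⟩ := hf
  exact ⟨C, fun k _ _ => hC k t ht⟩

theorem integral {f : ι → ℝ → E} (hf : UniformlyBounded T f) :
    UniformlyBounded T fun k t => ∫ s in (0 : ℝ)..t, f k s := by
  obtain ⟨C, hC⟩ := hf
  refine ⟨|C| * T, fun k t ht => ?_⟩
  have h : ‖∫ s in (0 : ℝ)..t, f k s‖ ≤ |C| * |t - 0| := by
    refine intervalIntegral.norm_integral_le_of_norm_le_const fun s hs => ?_
    rw [Set.uIoc_of_le ht.1] at hs
    exact (hC k s ⟨hs.1.le, hs.2.trans ht.2⟩).trans (le_abs_self C)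
  refine h.trans (mul_le_mul_of_nonneg_left ?_ (abs_nonneg C))
  rw [sub_zero, abs_of_nonneg ht.1]
  exact ht.2

theorem duhamel [FiniteDimensional ℝ E] (A : E →L[ℝ] E) {v₀ : ι → E} {f : ι → ℝ → E}
    (hv : UniformlyBounded T fun k _ => v₀ k) (hf : UniformlyBounded T f) :
    UniformlyBounded T fun k => duhamel A (v₀ k) (f k) := by
  have : CompleteSpace E := FiniteDimensional.complete ℝ E
  have : ProperSpace E := FiniteDimensional.proper ℝ E
  have hΦ := continuous_propagator A
  have h1 := ((of_continuous (ι := ι) (T := T) continuous_id).prodMk hf).comp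
    (g := fun p : ℝ × E => propagator A (-p.1) p.2)
    ((hΦ.comp continuous_fst.neg).clm_apply continuous_snd)
  exact ((of_continuous (ι := ι) (T := T) continuous_id).prodMk (hv.prodMk h1.integral)).comp
    (g := fun p : ℝ × E × E => propagator A p.1 (p.2.1 + p.2.2))
    ((hΦ.comp continuous_fst).clm_apply
      (continuous_snd.fst.add continuous_snd.snd))

end UniformlyBounded

end UniformBound

/-! ### Reaching the last coordinate with fast controls. -/

/-- A continuous bounded perturbation of a nonconstant linear function of one variable is onto. -/
theorem surjective_add_mul_of_bounded {f : ℝ → ℝ} (hf : Continuous f) {C : ℝ}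
    (hC : ∀ k, |f k| ≤ C) {κ : ℝ} (hκ : κ ≠ 0) : Function.Surjective fun k => f k + k * κ := by
  have hcont : Continuous fun k => f k + k * κ := by fun_prop
  have hup : ∀ k, f k ≤ C := fun k => (le_abs_self _).trans (hC k)
  have hlow : ∀ k, -C ≤ f k := fun k => (abs_le.1 (hC k)).1
  rcases hκ.lt_or_gt with h | h
  · refine hcont.surjective' ?_ ?_
    · exact Filter.tendsto_atTop_add_left_of_le _ _ hlow
        (Filter.tendsto_id.atBot_mul_const_of_neg h)
    · exact Filter.tendsto_atBot_add_left_of_ge _ _ hup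
        (Filter.tendsto_id.atTop_mul_const_of_neg h)
  · refine hcont.surjective ?_ ?_
    · exact Filter.tendsto_atTop_add_left_of_le _ _ hlow (Filter.tendsto_id.atTop_mul_const h)
    · exact Filter.tendsto_atBot_add_left_of_ge _ _ hup (Filter.tendsto_id.atBot_mul_const h)

/-- The response to a unit input, `w T = ∫ exp (λ (T - s)) ds`, is positive whatever the sign of
`λ`; it carries the drift `k κ` to time `T`. -/
theorem exists_scalar_response (lam : ℝ) {T : ℝ} (hT : 0 < T) :
    ∃ w : ℝ → ℝ, w 0 = 0 ∧ w T ≠ 0 ∧ ∀ t, HasDerivAt w (lam * w t + 1) t := by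
  have hc : Continuous fun s : ℝ => Real.exp (-(lam * s)) := by fun_prop
  refine ⟨fun t => Real.exp (lam * t) * ∫ s in (0 : ℝ)..t, Real.exp (-(lam * s)), by simp, ?_,
    fun t => ?_⟩
  · exact (mul_pos (Real.exp_pos _) (intervalIntegral.integral_pos hT hc.continuousOn
      (fun _ _ => (Real.exp_pos _).le) ⟨0, ⟨le_rfl, hT.le⟩, Real.exp_pos _⟩)).ne'
  · have h := (((hasDerivAt_id t).const_mul lam).exp).mul
      (hc.integral_hasStrictDerivAt 0 t).hasDerivAt
    refine h.congr_deriv ?_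
    have h1 : Real.exp (lam * t) * Real.exp (-(lam * t)) = 1 := by
      rw [← Real.exp_add, add_neg_cancel, Real.exp_zero]
    simp only [id, h1]
    ring

/-- A linear system `v' = A v + b u` satisfying Kalman's condition, coupled with a scalar equation
`z' = λ z + F v + c u + β (b u, v)`, is controllable in time `T` if there is a one-parameter family
of fast controls `q k` whose primitives `P k` (for `b q`) and `C k` are bounded, while the part
of the action of `q k` on `z` that does not integrate to a bounded term is `k κ` with `κ ≠ 0`. -/
theorem exists_steering {E ι : Type*} [NormedAddCommGroup E] [NormedSpace ℝ E]
    [FiniteDimensional ℝ E] [Fintype ι]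
    (A : E →L[ℝ] E) (b : (ι → ℝ) →L[ℝ] E) (lam : ℝ) {F : E → ℝ} (hF : Continuous F)
    (c : (ι → ℝ) →L[ℝ] ℝ) (β : E →L[ℝ] E →L[ℝ] ℝ)
    (hA : ∀ ψ : E →L[ℝ] ℝ, (∀ (k : ℕ) w, ψ ((A ^ k) (b w)) = 0) → ψ = 0) {T : ℝ} (hT : 0 < T)
    {q : ℝ → ℝ → ι → ℝ} {P : ℝ → ℝ → E} {C C' : ℝ → ℝ → ℝ} {κ : ℝ} (hκ : κ ≠ 0)
    (hq : Continuous (Function.uncurry q)) (hP : Continuous (Function.uncurry P))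
    (hC : Continuous (Function.uncurry C))
    (hPb : UniformlyBounded T P) (hCb : UniformlyBounded T C)
    (hPd : ∀ k t, HasDerivAt (P k) (b (q k t)) t) (hCd : ∀ k t, HasDerivAt (C k) (C' k t) t)
    (hqκ : ∀ k t, c (q k t) + (β (b (q k t)) (P k t) - β (P k t) (b (q k t))) / 2 =
      C' k t + k * κ)
    (v₀ v₁ : E) (z₀ z₁ : ℝ) :
    ∃ (u : ℝ → ι → ℝ) (v : ℝ → E) (z : ℝ → ℝ), Continuous u ∧
      (∀ t, HasDerivAt v (A (v t) + b (u t)) t) ∧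
      (∀ t, HasDerivAt z (lam * z t + F (v t) + c (u t) + β (b (u t)) (v t)) t) ∧
      v 0 = v₀ ∧ z 0 = z₀ ∧ v T = v₁ ∧ z T = z₁ := by
  have : CompleteSpace E := FiniteDimensional.complete ℝ E
  have : ProperSpace E := FiniteDimensional.proper ℝ E
  have h0 : (0 : ℝ) ∈ Set.Icc 0 T := ⟨le_rfl, hT.le⟩
  have h1 : T ∈ Set.Icc 0 T := ⟨hT.le, le_rfl⟩
  obtain ⟨R, hR, hRξ⟩ := exists_controlMap_rightInverse (controlMap_surjective A b hA hT)
  obtain ⟨w, hw0, hwT, hwd⟩ := exists_scalar_response lam hT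
  have hΦ := continuous_propagator A
  have hAP : Continuous (Function.uncurry fun k s => A (P k s)) := A.continuous.comp hP
  have hPt (t : ℝ) : Continuous fun k => P k t := hP.comp (continuous_id.prodMk continuous_const)
  -- the correction that makes the final state independent of `k`
  set ξ : ℝ → E := fun k => propagator A (-T) (v₁ - P k T) - duhamel 0 (v₀ - P k 0)
    (fun s => propagator A (-s) (A (P k s))) T with hξ
  -- With generator `0`, `duhamel` is a plain primitive; `ξ` is written this way so that the
  -- continuity and boundedness lemmas for `duhamel` apply to it.
  have hdz : ∀ (x : E) (f : ℝ → E) t, duhamel 0 x f t = x + ∫ s in (0 : ℝ)..t, f s := by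
    intro x f t
    have : ∀ t, propagator (0 : E →L[ℝ] E) t = 1 := fun t => by
      simp [propagator, NormedSpace.exp_zero]
    simp [duhamel, this]
  have hξc : Continuous ξ := by
    refine ((hΦ.comp continuous_const).clm_apply (continuous_const.sub (hPt T))).sub ?_
    refine (continuous_duhamel 0 (continuous_const.sub (hPt 0))
      (f := fun k s => propagator A (-s) (A (P k s))) ?_).comp
      (continuous_id.prodMk continuous_const)
    exact (hΦ.comp continuous_snd.neg).clm_apply hAP
  have htb : UniformlyBounded T fun (_ : ℝ) (t : ℝ) => t :=
    UniformlyBounded.of_continuous continuous_id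
  have hξb : UniformlyBounded T fun k (_ : ℝ) => ξ k := by
    have e1 := (hPb.at_time h1).comp (g := fun p => propagator A (-T) (v₁ - p)) (by fun_prop)
    have e2 := (htb.prodMk hPb).comp (g := fun p : ℝ × E => propagator A (-p.1) (A p.2))
      ((hΦ.comp continuous_fst.neg).clm_apply (by fun_prop))
    have e3 := ((hPb.at_time h0).comp (g := fun p => v₀ - p) (by fun_prop)).duhamel 0 e2
    exact (e1.prodMk (e3.at_time h1)).comp (g := fun p : E × E => p.1 - p.2) (by fun_prop)
  set r : ℝ → ℝ → ι → ℝ := fun k t => R (ξ k) t with hr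
  have hrc : Continuous (Function.uncurry r) :=
    hR.comp ((hξc.comp continuous_fst).prodMk continuous_snd)
  have hrb : UniformlyBounded T r := (hξb.prodMk htb).comp hR
  -- Writing `v = P k + η k` and `u = q k + r k` removes the unbounded `q k`: `η' = A η + f` has a
  -- bounded source.
  set f : ℝ → ℝ → E := fun k t => A (P k t) + b (r k t) with hf
  have hfc : Continuous (Function.uncurry f) := hAP.add (b.continuous.comp hrc)
  have hfb : UniformlyBounded T f := (hPb.prodMk hrb).comp
    (g := fun p : E × (ι → ℝ) => A p.1 + b p.2) (by fun_prop)
  set η : ℝ → ℝ → E := fun k => duhamel A (v₀ - P k 0) (f k) with hη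
  have hηc : Continuous (Function.uncurry η) :=
    continuous_duhamel A (continuous_const.sub (hPt 0)) hfc
  have hηb : UniformlyBounded T η :=
    ((hPb.at_time h0).comp (g := fun p => v₀ - p) (by fun_prop)).duhamel A hfb
  have hηd : ∀ k t, HasDerivAt (η k) (A (η k t) + f k t) t := fun k t =>
    hasDerivAt_duhamel A _ (hfc.uncurry_left k) t
  have hη0 : ∀ k, η k 0 = v₀ - P k 0 := fun k => duhamel_zero _ _ _
  have hηT : ∀ k, η k T = v₁ - P k T := by
    intro k
    have i1 := (continuous_propagator_neg_apply A (hAP.uncurry_left k)).intervalIntegrable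
      (μ := MeasureTheory.volume) 0 T
    have i2 := (continuous_propagator_neg_apply A (b.continuous.comp
      (hrc.uncurry_left k))).intervalIntegrable (μ := MeasureTheory.volume) 0 T
    have i3 := intervalIntegral.integral_add i1 i2
    simp only [Function.comp_apply, hr, hRξ] at i3
    simp only [hη, duhamel, hf, map_add (propagator A _) (A _) _, hr]
    rw [i3]
    simp only [hξ, hdz]
    rw [← propagator_apply_neg A T (v₁ - P k T)]
    congr 1
    simp only [propagator_apply_neg]
    abel
  -- Integration by parts: `β (P', η)` and the symmetric half of `β (P', P)` are derivatives up to
  -- bounded terms, collected in `H`. The antisymmetric half and `c q` give `C' + k κ` by `hqκ`. So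
  -- `z = ζ + k κ w + S`, with `ζ` and `S` bounded.
  set S : ℝ → ℝ → ℝ := fun k t => C k t + β (P k t) (η k t) + β (P k t) (P k t) / 2 with hS
  set H : ℝ → ℝ → ℝ := fun k t => lam * S k t + F (P k t + η k t) + c (r k t)
    + β (b (r k t)) (P k t + η k t) - β (P k t) (A (η k t) + f k t) with hH
  have hSc : Continuous (Function.uncurry S) := by
    have : Continuous fun p : ℝ × E × E => p.1 + β p.2.1 p.2.2 + β p.2.1 p.2.1 / 2 := by fun_prop
    exact this.comp (hC.prodMk (hP.prodMk hηc))
  have hSb : UniformlyBounded T S := (hCb.prodMk (hPb.prodMk hηb)).comp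
    (g := fun p : ℝ × E × E => p.1 + β p.2.1 p.2.2 + β p.2.1 p.2.1 / 2) (by fun_prop)
  have hHg : Continuous fun p : ℝ × E × E × (ι → ℝ) × E => lam * p.1 + F (p.2.1 + p.2.2.1)
      + c p.2.2.2.1 + β (b p.2.2.2.1) (p.2.1 + p.2.2.1) - β p.2.1 (A p.2.2.1 + p.2.2.2.2) := by
    fun_prop
  have hHc : Continuous (Function.uncurry H) :=
    hHg.comp (hSc.prodMk (hP.prodMk (hηc.prodMk (hrc.prodMk hfc))))
  have hHb : UniformlyBounded T H :=
    (hSb.prodMk (hPb.prodMk (hηb.prodMk (hrb.prodMk hfb)))).comp hHg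
  set Λ : ℝ →L[ℝ] ℝ := lam • ContinuousLinearMap.id ℝ ℝ with hΛ
  have hSt (t : ℝ) : Continuous fun k => S k t := hSc.comp (continuous_id.prodMk continuous_const)
  set ζ : ℝ → ℝ → ℝ := fun k => duhamel Λ (z₀ - S k 0) (H k) with hζ
  have hζd : ∀ k t, HasDerivAt (ζ k) (lam * ζ k t + H k t) t := fun k t =>
    hasDerivAt_duhamel Λ _ (hHc.uncurry_left k) t
  have hζc : Continuous fun k => ζ k T + S k T :=
    ((continuous_duhamel Λ (continuous_const.sub (hSt 0)) hHc).comp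
      (continuous_id.prodMk continuous_const)).add (hSt T)
  have hζb : UniformlyBounded T ζ :=
    ((hSb.at_time h0).comp (g := fun p => z₀ - p) (by fun_prop)).duhamel Λ hHb
  obtain ⟨M, hM⟩ := ((hζb.prodMk hSb).comp (g := fun p : ℝ × ℝ => p.1 + p.2)
    (by fun_prop)).at_time h1
  obtain ⟨k, hk⟩ := surjective_add_mul_of_bounded hζc (fun k => hM k T h1)
    (mul_ne_zero hκ hwT) z₁
  refine ⟨fun t => q k t + r k t, fun t => P k t + η k t,
    fun t => ζ k t + k * κ * w t + S k t, (hq.uncurry_left k).add (hrc.uncurry_left k), fun t => ?_, fun t => ?_,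
    ?_, ?_, ?_, ?_⟩
  · refine ((hPd k t).add (hηd k t)).congr_deriv ?_
    simp only [hf, map_add]
    abel
  · have hSd : HasDerivAt (S k) (C' k t + (β (P k t) (A (η k t) + f k t) + β (b (q k t)) (η k t))
        + (β (P k t) (b (q k t)) + β (b (q k t)) (P k t)) / 2) t :=
      ((hCd k t).add (ContinuousLinearMap.hasDerivAt_of_bilinear (B := β)
        (fun _ => hPd k t) (fun _ => hηd k t))).add
        ((ContinuousLinearMap.hasDerivAt_of_bilinear (B := β)
          (fun _ => hPd k t) (fun _ => hPd k t)).div_const 2)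
    refine (((hζd k t).add ((hwd t).const_mul (k * κ))).add hSd).congr_deriv ?_
    have := hqκ k t
    simp only [hH, map_add, add_apply] at this ⊢
    linear_combination -this
  · simp [hη0]
  · simp [hζ, duhamel_zero, hw0]
  · simp [hηT]
  · simp only at hk ⊢
    linear_combination hk


/-! ### Right-invariant and linear vector fields in coordinates. -/

namespace Heis

variable {n : ℕ}

@[simp] theorem sub_x (g h : Heis n) : (g - h).x = g.x - h.x := rfl
@[simp] theorem sub_y (g h : Heis n) : (g - h).y = g.y - h.y := rfl
@[simp] theorem sub_z (g h : Heis n) : (g - h).z = g.z - h.z := rfl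

/-- The projection `(x, y, z) ↦ (x, y)`. -/
noncomputable def horizontal (n : ℕ) : Heis n →L[ℝ] (Fin n → ℝ) × (Fin n → ℝ) :=
  LinearMap.toContinuousLinearMap
    { toFun := fun g => (g.x, g.y), map_add' := fun _ _ => rfl, map_smul' := fun _ _ => rfl }

/-- The coordinate `z`, as a linear form. -/
noncomputable def vertical (n : ℕ) : Heis n →L[ℝ] ℝ :=
  LinearMap.toContinuousLinearMap
    { toFun := fun g => g.z, map_add' := fun _ _ => rfl, map_smul' := fun _ _ => rfl }

@[simp] theorem horizontal_apply (g : Heis n) : horizontal n g = (g.x, g.y) := rfl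

@[simp] theorem vertical_apply (g : Heis n) : vertical n g = g.z := rfl

/-- The inclusion of the horizontal space, `(x, y) ↦ (x, y, 0)`. -/
noncomputable def ofHorizontal (n : ℕ) : (Fin n → ℝ) × (Fin n → ℝ) →L[ℝ] Heis n :=
  LinearMap.toContinuousLinearMap
    { toFun := fun v => mk v.1 v.2 0
      map_add' := fun _ _ => ext_coord rfl rfl (by simp)
      map_smul' := fun _ _ => ext_coord rfl rfl (by simp) }

@[simp] theorem ofHorizontal_apply (v : (Fin n → ℝ) × (Fin n → ℝ)) :
    ofHorizontal n v = mk v.1 v.2 0 := rfl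

/-- The inclusion of the centre, `z ↦ (0, 0, z)`. -/
noncomputable def ofVertical (n : ℕ) : ℝ →L[ℝ] Heis n :=
  LinearMap.toContinuousLinearMap
    { toFun := fun z => mk 0 0 z
      map_add' := fun _ _ => ext_coord (by simp) (by simp) (by simp)
      map_smul' := fun _ _ => ext_coord (by simp) (by simp) (by simp) }

@[simp] theorem ofVertical_apply (z : ℝ) : ofVertical n z = mk 0 0 z := rfl

theorem ext_horizontal {g h : Heis n} (h1 : horizontal n g = horizontal n h) (h2 : g.z = h.z) :
    g = h :=
  ext_coord (Prod.ext_iff.1 h1).1 (Prod.ext_iff.1 h1).2 h2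

/-- The bilinear form `((a, b), (x, y)) ↦ b · x`. -/
noncomputable def pairing (n : ℕ) :
    (Fin n → ℝ) × (Fin n → ℝ) →L[ℝ] (Fin n → ℝ) × (Fin n → ℝ) →L[ℝ] ℝ :=
  ∑ i, ((ContinuousLinearMap.proj i).comp (ContinuousLinearMap.snd ℝ _ _)).smulRight
    ((ContinuousLinearMap.proj i).comp (ContinuousLinearMap.fst ℝ _ _))

theorem pairing_apply (w v : (Fin n → ℝ) × (Fin n → ℝ)) :
    pairing n w v = ∑ i, w.2 i * v.1 i := by
  simp [pairing]

/-- The right-invariant vector field with value `e` at the identity. -/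
noncomputable def rightField (n : ℕ) : Heis n →ₗ[ℝ] HeisField n where
  toFun e g := e + ofVertical n (pairing n (horizontal n e) (horizontal n g))
  map_add' e f := by
    funext g
    simp only [map_add, add_apply, Pi.add_apply]
    abel
  map_smul' a e := by
    funext g
    simp only [map_smul, smul_apply, Pi.smul_apply, smul_add, RingHom.id_apply]

theorem rightField_apply (e g : Heis n) :
    rightField n e g = e + ofVertical n (pairing n (horizontal n e) (horizontal n g)) := rfl

theorem hasFDerivAt_rightField (e g : Heis n) : HasFDerivAt (rightField n e)
    ((ofVertical n).comp ((pairing n (horizontal n e)).comp (horizontal n))) g :=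
  ((ofVertical n).comp ((pairing n (horizontal n e)).comp (horizontal n))).hasFDerivAt.const_add e

theorem contDiff_rightField (e : Heis n) : ContDiff ℝ ∞ (rightField n e) :=
  contDiff_const.add
    ((ofVertical n).comp ((pairing n (horizontal n e)).comp (horizontal n))).contDiff

/-- Right translation is affine in these coordinates. -/
theorem fderiv_mul_right (g h w : Heis n) :
    fderiv ℝ (fun k : Heis n => k * h) g w = rightField n w h := by
  set L : Heis n →L[ℝ] Heis n := ContinuousLinearMap.id ℝ (Heis n) +
    (ofVertical n).comp (((pairing n).flip (horizontal n h)).comp (horizontal n)) with hL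
  have h1 : (fun k : Heis n => k * h) = fun k => L k + h := by
    funext k
    apply ext_coord <;> simp [hL, pairing_apply, -map_sum]
    ring
  rw [h1, (L.hasFDerivAt.add_const h).fderiv]
  simp [hL, rightField_apply]

theorem isRightInvariant_rightField (e : Heis n) : IsRightInvariant (rightField n e) := by
  intro g h
  rw [fderiv_mul_right]
  apply ext_coord <;> simp [-map_sum, rightField_apply, pairing_apply, mul_add, Finset.sum_add_distrib]
  ring

theorem _root_.IsRightInvariant.eq_rightField {B : HeisField n} (hB : IsRightInvariant B) :
    B = rightField n (B 1) := by
  funext h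
  have := hB 1 h
  rwa [one_mul, fderiv_mul_right] at this

theorem rightField_one (e : Heis n) : rightField n e 1 = e := by
  apply ext_coord <;> simp [-map_sum, rightField_apply, pairing_apply]

theorem heisZ_eq_rightField : heisZ n = rightField n (mk 0 0 1) := by
  funext g
  apply ext_coord <;> simp [-map_sum, rightField_apply, pairing_apply, heisZ]

/-- The derivative of a right-invariant field sees only horizontal directions and takes vertical
values, so only the antisymmetric part of `pairing` survives. -/
theorem lieBracket_rightField (e f : Heis n) :
    VectorField.lieBracket ℝ (rightField n e) (rightField n f) =
      rightField n (mk 0 0 (pairing n (horizontal n f) (horizontal n e) -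
        pairing n (horizontal n e) (horizontal n f))) := by
  funext g
  rw [VectorField.lieBracket, (hasFDerivAt_rightField f g).fderiv,
    (hasFDerivAt_rightField e g).fderiv]
  apply ext_coord <;> simp [-map_sum, rightField_apply, pairing_apply]

theorem fderiv_horizontal {Y : HeisField n} (hY : ContDiff ℝ ∞ Y) (g w : Heis n) :
    fderiv ℝ (fun h => horizontal n (Y h)) g w = horizontal n (fderiv ℝ Y g w) := by
  have := ((horizontal n).hasFDerivAt.comp g (hY.differentiable (by simp) g).hasFDerivAt).fderiv
  exact congrArg (fun L : Heis n →L[ℝ] _ => L w) this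

/-- A linear vector field is linear in `(x, y)`, and affine in `z` with constant slope. -/
theorem _root_.IsLinearField.exists_coordinates {𝒳 : HeisField n} (h𝒳 : IsLinearField 𝒳) :
    ∃ (A : (Fin n → ℝ) × (Fin n → ℝ) →L[ℝ] (Fin n → ℝ) × (Fin n → ℝ)) (lam : ℝ)
      (F : (Fin n → ℝ) × (Fin n → ℝ) → ℝ), Continuous F ∧
      (∀ g, horizontal n (𝒳 g) = A (horizontal n g)) ∧
      ∀ g, (𝒳 g).z = lam * g.z + F (horizontal n g) := by
  obtain ⟨hsm, φ, hφ0, -, hφ⟩ := h𝒳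
  have hd : ∀ g, HasDerivAt (fun s => φ s g) (𝒳 g) 0 := fun g => by
    simpa [hφ0] using hφ g 0
  have hdh : ∀ g, HasDerivAt (fun s => horizontal n (φ s g)) (horizontal n (𝒳 g)) 0 := fun g =>
    (horizontal n).hasFDerivAt.comp_hasDerivAt 0 (hd g)
  have hdz : ∀ g, HasDerivAt (fun s => (φ s g).z) (𝒳 g).z 0 := fun g =>
    (vertical n).hasFDerivAt.comp_hasDerivAt 0 (hd g)
  -- Differentiate `φ s (g * h) = φ s g * φ s h` at `s = 0`.
  have hmul : ∀ g h, horizontal n (𝒳 (g * h)) = horizontal n (𝒳 g) + horizontal n (𝒳 h) := by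
    intro g h
    refine (hdh (g * h)).unique (((hdh g).add (hdh h)).congr_of_eventuallyEq
      (Filter.Eventually.of_forall fun s => ?_))
    simp
  have hmulz : ∀ g h, (𝒳 (g * h)).z = (𝒳 g).z + (𝒳 h).z +
      (pairing n (horizontal n g) (horizontal n (𝒳 h)) +
        pairing n (horizontal n (𝒳 g)) (horizontal n h)) := by
    intro g h
    have hp := ContinuousLinearMap.hasDerivAt_of_bilinear (B := pairing n) (x := (0 : ℝ))
      (fun _ => hdh g) (fun _ => hdh h)
    simp only [hφ0] at hp
    refine (hdz (g * h)).unique ((((hdz g).add (hdz h)).add hp).congr_of_eventuallyEq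
      (Filter.Eventually.of_forall fun s => ?_))
    simp [pairing_apply]
  -- For `n ≥ 1` central elements are commutators, which the additive map of `hmul` kills; for `n =
  -- 0` there is no horizontal direction.
  have hcentral : ∀ s, horizontal n (𝒳 (mk 0 0 s)) = 0 := by
    intro s
    rcases n with _ | n
    · exact Subsingleton.elim _ _
    · have h1 : (mk 0 (Pi.single 0 s) 0 * mk (Pi.single 0 1) 0 0 : Heis (n + 1)) =
          mk (Pi.single 0 1) 0 0 * mk 0 (Pi.single 0 s) 0 * mk 0 0 s := by
        apply ext_coord <;> simp [Pi.single_apply]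
      have h2 := congrArg (fun g => horizontal (n + 1) (𝒳 g)) h1
      simp only [hmul] at h2
      rw [add_comm (horizontal (n + 1) (𝒳 (mk 0 (Pi.single 0 s) 0))), left_eq_add] at h2
      exact h2
  have hsplit : ∀ g : Heis n, g = ofHorizontal n (horizontal n g) * mk 0 0 g.z := fun g => by
    apply ext_coord <;> simp
  have hX (g : Heis n) : horizontal n (𝒳 g) = horizontal n (𝒳 (ofHorizontal n (horizontal n g))) := by
    conv_lhs => rw [hsplit g, hmul, hcentral, add_zero]
  have hXz : ∀ g : Heis n, (𝒳 g).z = (𝒳 (ofHorizontal n (horizontal n g))).z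
      + (𝒳 (mk 0 0 g.z)).z := by
    intro g
    conv_lhs => rw [hsplit g, hmulz, hcentral]
    simp [pairing_apply]
  -- Additive and continuous, hence real-linear; likewise for `ℓ₀`, whose value at `1` is the slope
  -- in `z`.
  let A₀ : (Fin n → ℝ) × (Fin n → ℝ) →+ (Fin n → ℝ) × (Fin n → ℝ) :=
    AddMonoidHom.mk' (fun v => horizontal n (𝒳 (ofHorizontal n v))) fun v w => by
      rw [← hmul, hX (_ * _)]
      rfl
  let ℓ₀ : ℝ →+ ℝ := AddMonoidHom.mk' (fun s => (𝒳 (mk 0 0 s)).z) fun s t => by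
    have h1 : (mk 0 0 (s + t) : Heis n) = mk 0 0 s * mk 0 0 t := by apply ext_coord <;> simp
    have h2 : horizontal n (mk 0 0 t) = 0 := rfl
    simp only [h1, hmulz, hcentral, h2, map_zero, add_zero]
  have hA₀ : Continuous A₀ :=
    (horizontal n).continuous.comp (hsm.continuous.comp (ofHorizontal n).continuous)
  have hℓ₀ : Continuous ℓ₀ :=
    (vertical n).continuous.comp (hsm.continuous.comp (ofVertical n).continuous)
  refine ⟨A₀.toRealLinearMap hA₀, ℓ₀ 1, fun v => (𝒳 (ofHorizontal n v)).z,
    (vertical n).continuous.comp (hsm.continuous.comp (ofHorizontal n).continuous), hX, fun g => ?_⟩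
  rw [hXz g, add_comm]
  congr 1
  have := (ℓ₀.toRealLinearMap hℓ₀).map_smul g.z 1
  simp only [smul_eq_mul, mul_one] at this
  rw [mul_comm]
  exact this

/-! ### Consequences of the two Lie algebra hypotheses. -/

/-- The rank condition gives Kalman's condition for the horizontal part of the system. -/
theorem _root_.HeisRankCondition.eq_zero {m : ℕ} {𝒳 : HeisField n} {B : Fin m → HeisField n}
    (hrank : HeisRankCondition 𝒳 B) (hsm : ContDiff ℝ ∞ 𝒳) (hB : ∀ j, IsRightInvariant (B j))
    {A : (Fin n → ℝ) × (Fin n → ℝ) →L[ℝ] (Fin n → ℝ) × (Fin n → ℝ)}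
    (hA : ∀ g, horizontal n (𝒳 g) = A (horizontal n g))
    {ψ : (Fin n → ℝ) × (Fin n → ℝ) →L[ℝ] ℝ}
    (hψ : ∀ (k : ℕ) j, ψ ((A ^ k) (horizontal n (B j 1))) = 0) : ψ = 0 := by
  -- A space larger than needed: smooth fields with constant horizontal part in `ker ψ`. It is
  -- closed under brackets, which have zero horizontal part, and right invariance of `D^k B_j` need
  -- not be proved.
  let W : Submodule ℝ (HeisField n) :=
    { carrier := {Y | ContDiff ℝ ∞ Y ∧ ∃ b, ψ b = 0 ∧ ∀ g, horizontal n (Y g) = b}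
      zero_mem' := ⟨contDiff_const, 0, map_zero ψ, fun _ => map_zero _⟩
      add_mem' := fun {V Y} hV hY => by
        obtain ⟨hV, b, hb, hVb⟩ := hV
        obtain ⟨hY, b', hb', hYb⟩ := hY
        refine ⟨hV.add hY, b + b', by rw [map_add, hb, hb', add_zero], fun g => ?_⟩
        rw [Pi.add_apply, map_add, hVb, hYb]
      smul_mem' := fun a Y hY => by
        obtain ⟨hY, b, hb, hYb⟩ := hY
        refine ⟨contDiff_const.smul hY, a • b, by rw [map_smul, hb, smul_zero], fun g => ?_⟩
        rw [Pi.smul_apply, map_smul, hYb] }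
  have hle : lieGenerated {Y | ∃ (k : ℕ) (j : Fin m), Y = (adDer 𝒳)^[k] (B j)} ≤ W := by
    refine sInf_le ⟨?_, ?_⟩
    · rintro _ ⟨k, j, rfl⟩
      suffices h : ContDiff ℝ ∞ ((adDer 𝒳)^[k] (B j)) ∧
          ∀ g, horizontal n ((adDer 𝒳)^[k] (B j) g) = (A ^ k) (horizontal n (B j 1)) from
        ⟨h.1, _, hψ k j, h.2⟩
      induction k with
      | zero =>
        rw [Function.iterate_zero_apply, (hB j).eq_rightField]
        refine ⟨contDiff_rightField _, fun g => ?_⟩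
        rw [rightField_one]
        simp [rightField_apply]
      | succ k ih =>
        -- The horizontal part of the iterate is constant, so only the derivative of `𝒳`
        -- contributes; the sign in `D = -ad` makes it `+A`.
        rw [Function.iterate_succ_apply']
        refine ⟨(hsm.lieBracket_vectorField ih.1 (by simp)).neg, fun g => ?_⟩
        have h1 := fderiv_horizontal ih.1 g (𝒳 g)
        have h2 := fderiv_horizontal hsm g ((adDer 𝒳)^[k] (B j) g)
        simp only [ih.2, hA] at h1 h2
        have h3 : fderiv ℝ (fun h => A (horizontal n h)) g = A.comp (horizontal n) :=
          (A.comp (horizontal n)).fderiv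
        rw [h3] at h2
        simp only [adDer, Pi.neg_apply, VectorField.lieBracket, map_neg, map_sub, ← h1, ← h2,
          pow_succ']
        simp [ih.2]
    · rintro V ⟨hV, b, hb, hVb⟩ Y ⟨hY, b', hb', hYb⟩
      refine ⟨hV.lieBracket_vectorField hY (by simp), 0, map_zero ψ, fun g => ?_⟩
      have h1 := fderiv_horizontal hV g (Y g)
      have h2 := fderiv_horizontal hY g (V g)
      simp only [hVb, hYb] at h1 h2
      rw [VectorField.lieBracket, map_sub, ← h1, ← h2]
      simp
  refine ContinuousLinearMap.ext fun v => ?_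
  have hmem : rightField n (ofHorizontal n v) ∈
      (lieGenerated {Y | ∃ (k : ℕ) (j : Fin m), Y = (adDer 𝒳)^[k] (B j)} : Set (HeisField n)) := by
    rw [hrank]
    exact isRightInvariant_rightField _
  obtain ⟨-, b, hb, hvb⟩ := hle hmem
  have := hvb 1
  rw [rightField_one] at this
  rw [zero_apply, ← hb, ← this]
  rfl

/-- If the centre lies in the Lie algebra generated by right-invariant fields, then it lies in
their span, or two of them do not commute. -/
theorem exists_combination_or_noncommuting {m : ℕ} {e : Fin m → Heis n}
    (hZ : heisZ n ∈ lieGenerated (Set.range fun j => rightField n (e j))) :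
    (∃ w : Fin m → ℝ, ∑ j, w j • e j = mk 0 0 1) ∨
      ∃ i j, pairing n (horizontal n (e i)) (horizontal n (e j)) ≠
        pairing n (horizontal n (e j)) (horizontal n (e i)) := by
  by_contra! hcon
  obtain ⟨hw, hcomm⟩ := hcon
  set S := Submodule.span ℝ (Set.range e)
  have hS : ∀ f ∈ S, ∀ g ∈ S, pairing n (horizontal n f) (horizontal n g) =
      pairing n (horizontal n g) (horizontal n f) := by
    intro f hf g hg
    induction hf, hg using Submodule.span_induction₂ with
    | mem_mem x y hx hy =>
      obtain ⟨i, rfl⟩ := hx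
      obtain ⟨j, rfl⟩ := hy
      exact hcomm i j
    | zero_left => simp only [map_zero, zero_apply]
    | zero_right => simp only [map_zero, zero_apply]
    | add_left x y z _ _ _ h1 h2 => simp only [map_add, add_apply, h1, h2]
    | add_right x y z _ _ _ h1 h2 => simp only [map_add, add_apply, h1, h2]
    | smul_left a x y _ _ h => simp only [map_smul, smul_apply, h]
    | smul_right a x y _ _ h => simp only [map_smul, smul_apply, h]
  -- When all the fields commute, their span is already a Lie algebra.
  have hle : lieGenerated (Set.range fun j => rightField n (e j)) ≤ S.map (rightField n) := by
    refine sInf_le ⟨?_, ?_⟩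
    · rintro _ ⟨j, rfl⟩
      exact Submodule.mem_map_of_mem (Submodule.subset_span ⟨j, rfl⟩)
    · rintro _ ⟨f, hf, rfl⟩ _ ⟨g, hg, rfl⟩
      rw [lieBracket_rightField, hS f hf g hg, sub_self]
      exact Submodule.mem_map_of_mem S.zero_mem
  obtain ⟨f, hf, hfZ⟩ := hle hZ
  have h1 := congrFun hfZ 1
  rw [heisZ_eq_rightField, rightField_one, rightField_one] at h1
  subst h1
  obtain ⟨w, hw'⟩ := (Submodule.mem_span_range_iff_exists_fun ℝ).1 hf
  exact hw w hw'

end Heis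

/-! ### From solutions in coordinates to controllability. -/

namespace Heis

/-- A differentiable solution in coordinates, for a continuous control, is a trajectory. -/
theorem mem_reachableSet {n m : ℕ} {𝒳 : HeisField n} {B : Fin m → HeisField n} {T : ℝ}
    (h𝒳 : Continuous 𝒳) (hB : ∀ j, Continuous (B j)) {u : ℝ → Fin m → ℝ} (hu : Continuous u)
    {γ : ℝ → Heis n} (hγ : ∀ t, HasDerivAt γ (𝒳 (γ t) + ∑ j, u t j • B j (γ t)) t) :
    γ T ∈ reachableSet 𝒳 B (γ 0) T := by
  have hγc : Continuous γ := continuous_iff_continuousAt.2 fun t => (hγ t).continuousAt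
  refine ⟨u, hu.measurable, isCompact_Icc.exists_bound_of_continuousOn hu.continuousOn, γ,
    ⟨hγc.continuousOn, fun t _ => ?_⟩, rfl⟩
  have hc : Continuous fun t => 𝒳 (γ t) + ∑ j, u t j • B j (γ t) :=
    (h𝒳.comp hγc).add (continuous_finsetSum _ fun j _ =>
      ((continuous_apply j).comp hu).smul ((hB j).comp hγc))
  rw [intervalIntegral.integral_eq_sub_of_hasDerivAt (fun s _ => hγ s) (hc.intervalIntegrable 0 t)]
  abel

end Heis

open Heis in
theorem theorem7 (n m : ℕ) (𝒳 : HeisField n) (B : Fin m → HeisField n)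
    (h𝒳 : IsLinearField 𝒳) (hB : ∀ j, IsRightInvariant (B j))
    (hrank : HeisRankCondition 𝒳 B)
    (hZ : heisZ n ∈ lieGenerated (Set.range B)) :
    ∀ T : ℝ, 0 < T → ControllableInExactTime 𝒳 B T := by
  intro T hT g
  refine Set.eq_univ_of_forall fun h => ?_
  obtain ⟨A, lam, F, hF, hA, hXz⟩ := h𝒳.exists_coordinates
  obtain ⟨e, rfl⟩ : ∃ e : Fin m → Heis n, B = fun j => rightField n (e j) :=
    ⟨fun j => B j 1, funext fun j => (hB j).eq_rightField⟩
  set ε : (Fin m → ℝ) →L[ℝ] Heis n := LinearMap.toContinuousLinearMap (Fintype.linearCombination ℝ e)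
  have hε : ∀ w, ε w = ∑ j, w j • e j := fun w => Fintype.linearCombination_apply ℝ e w
  set b := (horizontal n).comp ε with hb
  set c := (vertical n).comp ε with hc
  have hKalman : ∀ ψ : (Fin n → ℝ) × (Fin n → ℝ) →L[ℝ] ℝ,
      (∀ (k : ℕ) w, ψ ((A ^ k) (b w)) = 0) → ψ = 0 := by
    intro ψ hψ
    refine hrank.eq_zero h𝒳.1 hB hA fun k j => ?_
    have := hψ k (Pi.single j 1)
    rw [hb, ContinuousLinearMap.comp_apply, hε] at this
    simpa only [Pi.single_apply, ite_smul, one_smul, zero_smul, Finset.sum_ite_eq',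
      Finset.mem_univ, if_true, rightField_one] using this
  obtain ⟨u, v, z, hu, hv, hz, hv0, hz0, hvT, hzT⟩ : ∃ (u : ℝ → Fin m → ℝ)
      (v : ℝ → (Fin n → ℝ) × (Fin n → ℝ)) (z : ℝ → ℝ), Continuous u ∧
      (∀ t, HasDerivAt v (A (v t) + b (u t)) t) ∧
      (∀ t, HasDerivAt z (lam * z t + F (v t) + c (u t) + pairing n (b (u t)) (v t)) t) ∧
      v 0 = horizontal n g ∧ z 0 = g.z ∧ v T = horizontal n h ∧ z T = h.z := by
    rcases exists_combination_or_noncommuting hZ with ⟨w, hw⟩ | ⟨i, j, hij⟩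
    · have hbw : b w = 0 := by rw [hb, ContinuousLinearMap.comp_apply, hε, hw]; rfl
      have hcw : c w = 1 := by rw [hc, ContinuousLinearMap.comp_apply, hε, hw]; rfl
      refine exists_steering A b lam hF c (pairing n) hKalman hT (q := fun k _ => k • w)
        (P := fun _ _ => 0) (C := fun _ _ => 0) (C' := fun _ _ => 0) one_ne_zero
        (by fun_prop) continuous_const continuous_const
        (.of_continuous continuous_const) (.of_continuous continuous_const)
        (fun k t => ?_) (fun k t => hasDerivAt_const t 0) (fun k t => ?_) _ _ _ _
      · simpa [hbw] using hasDerivAt_const t (0 : (Fin n → ℝ) × (Fin n → ℝ))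
      · simp [hcw]
    -- A unit circle in the plane of controls `i`, `j`, run at frequency `k`: `p` stays bounded
    -- while its derivative `q` sweeps area at a rate proportional to `k`.
    · set p : ℝ → ℝ → Fin m → ℝ := fun k t =>
        Real.cos (k * t) • Pi.single i 1 + Real.sin (k * t) • Pi.single j 1 with hp
      set q : ℝ → ℝ → Fin m → ℝ := fun k t =>
        (-Real.sin (k * t) * k) • Pi.single i 1 + (Real.cos (k * t) * k) • Pi.single j 1 with hq
      have hpc : Continuous (Function.uncurry p) := by
        simp only [hp, Function.uncurry_def]; fun_prop
      have hqc : Continuous (Function.uncurry q) := by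
        simp only [hq, Function.uncurry_def]; fun_prop
      have hpd : ∀ k t, HasDerivAt (p k) (q k t) t := fun k t => by
        have hk : HasDerivAt (fun t => k * t) k t := by
          simpa using (hasDerivAt_id t).const_mul k
        exact (hk.cos.smul_const _).add (hk.sin.smul_const _)
      have hpb : UniformlyBounded T p := by
        have hcs : UniformlyBounded T fun k t : ℝ => (Real.cos (k * t), Real.sin (k * t)) :=
          ⟨1, fun k t _ => max_le (Real.abs_cos_le_one _) (Real.abs_sin_le_one _)⟩
        exact hcs.comp (g := fun x : ℝ × ℝ =>
          x.1 • (Pi.single i 1 : Fin m → ℝ) + x.2 • Pi.single j 1) (by fun_prop)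
      have hbe : ∀ i, b (Pi.single i 1) = horizontal n (e i) := fun i => by
        rw [hb, ContinuousLinearMap.comp_apply, hε]
        simp only [Pi.single_apply, ite_smul, one_smul, zero_smul, Finset.sum_ite_eq',
          Finset.mem_univ, if_true]
      refine exists_steering A b lam hF c (pairing n) hKalman hT (q := q)
        (P := fun k t => b (p k t)) (C := fun k t => c (p k t)) (C' := fun k t => c (q k t))
        (κ := (pairing n (horizontal n (e j)) (horizontal n (e i)) -
          pairing n (horizontal n (e i)) (horizontal n (e j))) / 2)
        (div_ne_zero (sub_ne_zero.2 hij.symm) two_ne_zero) hqc (b.continuous.comp hpc)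
        (c.continuous.comp hpc) (hpb.comp b.continuous) (hpb.comp c.continuous)
        (fun k t => b.hasFDerivAt.comp_hasDerivAt t (hpd k t))
        (fun k t => c.hasFDerivAt.comp_hasDerivAt t (hpd k t)) (fun k t => ?_) _ _ _ _
      simp only [hp, hq, map_add, map_smul, hbe, add_apply, smul_apply, smul_eq_mul]
      -- The swept area has constant rate because `sin² + cos² = 1`.
      linear_combination k * (pairing n (horizontal n (e j)) (horizontal n (e i)) -
        pairing n (horizontal n (e i)) (horizontal n (e j))) / 2 * Real.sin_sq_add_cos_sq (k * t)
  have hγ0 : ofHorizontal n (v 0) + ofVertical n (z 0) = g := by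
    rw [hv0, hz0]
    apply ext_coord <;> simp
  have hγT : ofHorizontal n (v T) + ofVertical n (z T) = h := by
    rw [hvT, hzT]
    apply ext_coord <;> simp
  have hmem := mem_reachableSet (T := T) h𝒳.1.continuous
    (fun j => (contDiff_rightField (e j)).continuous) hu
    (γ := fun t => ofHorizontal n (v t) + ofVertical n (z t)) fun t => by
      refine (((ofHorizontal n).hasFDerivAt.comp_hasDerivAt t (hv t)).add
        ((ofVertical n).hasFDerivAt.comp_hasDerivAt t (hz t))).congr_deriv ?_
      set γ := ofHorizontal n (v t) + ofVertical n (z t) with hγ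
      have h1 : horizontal n γ = v t := by simp [hγ]
      have h2 : γ.z = z t := by simp [hγ]
      have h3 : ∑ j, u t j • rightField n (e j) γ = rightField n (ε (u t)) γ := by
        rw [hε, map_sum, Finset.sum_apply]
        simp only [map_smul, Pi.smul_apply]
      rw [h3, rightField_apply]
      refine ext_horizontal ?_ ?_
      · rw [map_add _ (𝒳 γ), hA, h1]
        apply Prod.ext <;> simp [-map_sum, hb]
      · rw [add_z, add_z (𝒳 γ), hXz, h1, h2]
        simp [-map_sum, hb, hc]
        ring
  simpa only [hγ0, hγT] using hmem
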